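/- Let $n\ge 0$ and $m\ge 1$ be integers, let $\mathfrak h$ be a real Lie algebra of matrices (a Lie subalgebra of $\mathfrak{gl}_n(\mathbb R)=M_n(\mathbb R)$ with bracket $[A,B]=AB-BA$), and let $\mathfrak b_1,\dots,\mathfrak b_m,\mathfrak s$ be linear subspaces of $\mathfrak h$ such that the sum $\mathfrak b=\mathfrak b_1\oplus\dots\oplus\mathfrak b_m$ is direct. Let $b_\star=b_{\star,1}+\dots+b_{\star,m}\in\mathfrak b$ with $b_{\star,i}\in\mathfrak b_i$, and write $\mathrm{ad}_{b_\star}(s)=[b_\star,s]$. Suppose that $$\mathfrak g:=(\mathfrak b_1\oplus\dots\oplus\mathfrak b_m)+\mathrm{ad}_{b_\star}(\mathfrak s)$$ is a real Lie algebra (it is closed under the bracket), and that $[\mathfrak s,\mathfrak g]\subset\mathfrak g$ (which is automatic when $\mathfrak s\subset\mathfrak g$, for instance when $\mathfrak s$ is one of the $\mathfrak b_j$). Then there exist $t_0>0$ and an analytic function $t\in(-t_0,t_0)\mapsto(b_t,s_t)\in\mathfrak b\times\mathfrak s$, with components $b_t=b_{t,1}+\dots+b_{t,m}$, $b_{t,i}\in\mathfrak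 b_i$, such that $b_0=b_\star$ and $$\forall t\in(-t_0,t_0),\qquad e^{tb_\star}=e^{-ts_t}\,e^{tb_{t,1}}\cdots e^{tb_{t,m}}\,e^{ts_t}.$$ -/

import Mathlib

-- Square matrices carry the commutator bracket `⁅A, B⁆ = A * B - B * A`.
attribute [local instance 100] LieRing.ofAssociativeRing

-- A norm on square real matrices (the `ℓ^∞` operator norm), needed to speak of analytic maps.
-- All norms on this finite-dimensional space are equivalent, so analyticity does not depend on it.
attribute [local instance 50] Matrix.linftyOpNormedRing Matrix.linftyOpNormedAlgebra

open NormedSpace Filter Topology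

/-! Write `a` for b_⋆. The identity amounts to ∏ exp(t b_i) = exp(t w) with w = e^{ts} a e^{-ts},
and w lies in 𝔤 because 𝔰 normalizes 𝔤.

Put b = b_⋆ + tβ. In the defect exp(-tw) ∏ exp(t b_i) the terms of order t cancel, leaving 1 + t²R,
and at t = 0 the coefficient R is a constant plus ∑ β_i + [a, s]. The map (β, s) ↦ ∑ β_i + [a, s] is
onto 𝔤, so a linear right inverse parametrizes (β, s) by y ∈ 𝔤 and R becomes q + y at t = 0. With π
a projection onto 𝔤, the implicit function theorem solves πR = 0 analytically
(`exists_analyticAt_zero_of_apply_zero_eq`).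

This kills only the 𝔤-component of the defect. For fixed w and b in 𝔤, however, the curve τ ↦
exp(-τw) ∏ exp(τ b_i) starts at 1 with left logarithmic derivative in 𝔤, so it stays in a local leaf
on which π is injective near 1: the defect is then exactly 1
(`exists_nhds_one_isLeftTangent_eq_one`). -/

theorem exists_analyticOnNhd_exp_eq (A : Type*) [NormedRing A] [NormedAlgebra ℝ A]
    [CompleteSpace A] :
    ∃ φ : A → A, AnalyticOnNhd ℝ φ Set.univ ∧ ∀ x, exp x = 1 + x + x * x * φ x := by
  set c : ℕ → ℝ := fun k => ((k + 2).factorial : ℝ)⁻¹ with hc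
  have hrad : (FormalMultilinearSeries.ofScalars A c).radius = ⊤ := by
    refine FormalMultilinearSeries.ofScalars_radius_eq_top_of_tendsto A _
      (Eventually.of_forall fun k => by positivity) ?_
    have : (fun k : ℕ => ‖c k.succ‖ / ‖c k‖) = fun k : ℕ => 1 / (((k + 2 : ℕ) : ℝ) + 1) := by
      ext k
      have h : ((k + 2).factorial : ℝ) ≠ 0 := by positivity
      simp only [hc, Nat.succ_eq_add_one, show k + 1 + 2 = (k + 2) + 1 by ring,
        Nat.factorial_succ (k + 2), norm_inv, RCLike.norm_natCast]
      push_cast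
      field_simp
    rw [this]
    exact (tendsto_one_div_add_atTop_nhds_zero_nat (𝕜 := ℝ)).comp (tendsto_add_atTop_nat 2)
  have hps := (FormalMultilinearSeries.ofScalars A c).hasFPowerSeriesOnBall (by simp [hrad])
  rw [hrad] at hps
  refine ⟨_, fun x _ => hps.analyticAt_of_mem (by simp), fun x => ?_⟩
  have h1 := hps.hasSum (y := x) (by simp)
  simp only [FormalMultilinearSeries.ofScalars_apply_eq, zero_add] at h1
  have h2 := exp_series_hasSum_exp' (𝕂 := ℝ) x
  rw [← hasSum_nat_add_iff' 2] at h2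
  have h3 := h1.mul_left (x * x)
  have h4 : (fun k => x * x * c k • x ^ k) = fun k => (((k + 2).factorial : ℝ)⁻¹) • x ^ (k + 2) := by
    ext k
    rw [mul_smul_comm, pow_add, pow_two, (Commute.refl x).pow_left k |>.mul_right
      ((Commute.refl x).pow_left k) |>.eq]
  rw [h4] at h3
  have h5 := h2.unique h3
  simp only [Finset.sum_range_succ, Finset.sum_range_zero, Nat.factorial, pow_zero, pow_one] at h5
  norm_num at h5
  rw [← h5]
  abel

/-! ### Exponentials and conjugation -/

section
variable {A : Type*} [NormedRing A] [NormedAlgebra ℝ A] [CompleteSpace A]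

theorem exp_mul_exp_neg_self (x : A) : exp x * exp (-x) = 1 := by
  let := NormedAlgebra.restrictScalars ℚ ℝ A
  rw [← exp_add_of_commute (Commute.refl x).neg_right, add_neg_cancel, exp_zero]

theorem exp_neg_mul_exp_self (x : A) : exp (-x) * exp x = 1 := by
  simpa using exp_mul_exp_neg_self (-x)

theorem ContinuousLinearMap.exp_apply_mem {E : Type*} [NormedAddCommGroup E] [NormedSpace ℝ E]
    [CompleteSpace E] (T : E →L[ℝ] E) {W : Submodule ℝ E} (hW : IsClosed (W : Set E))
    (hT : ∀ v ∈ W, T v ∈ W) {v : E} (hv : v ∈ W) : exp T v ∈ W := by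
  have hpow : ∀ k, (T ^ k) v ∈ W := by
    intro k
    induction k with
    | zero => simpa using hv
    | succ k ih => rw [pow_succ']; exact hT _ ih
  exact hW.mem_of_tendsto
    ((exp_series_hasSum_exp' (𝕂 := ℝ) T).mapL (ContinuousLinearMap.apply ℝ E v))
    (Eventually.of_forall fun s => W.sum_mem fun k _ => by simpa using W.smul_mem _ (hpow k))

/-- Left and right multiplication by `x` commute, so the exponential of their difference factors
into the two multiplications by `exp x` and `exp (-x)`. -/
theorem exp_mul_mul_exp_neg (x y : A) :
    exp x * y * exp (-x) =
      exp (ContinuousLinearMap.mul ℝ A x - (ContinuousLinearMap.mul ℝ A).flip x) y := by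
  let := NormedAlgebra.restrictScalars ℚ ℝ A
  let : NormedAlgebra ℚ (A →L[ℝ] A) := NormedAlgebra.restrictScalars ℚ ℝ _
  have hcomm : Commute (ContinuousLinearMap.mul ℝ A x) (-(ContinuousLinearMap.mul ℝ A).flip x) := by
    ext z
    simp [mul_assoc]
  rw [sub_eq_add_neg, exp_add_of_commute hcomm]
  have h1 : exp (ContinuousLinearMap.mul ℝ A x) = ContinuousLinearMap.mul ℝ A (exp x) := by
    have := (exp_series_hasSum_exp' (𝕂 := ℝ) x).mapL (ContinuousLinearMap.mul ℝ A)
    refine (exp_series_hasSum_exp' (𝕂 := ℝ) (ContinuousLinearMap.mul ℝ A x)).unique ?_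
    have hpow : ∀ k : ℕ, (ContinuousLinearMap.mul ℝ A x) ^ k =
        ContinuousLinearMap.mul ℝ A (x ^ k) := by
      intro k
      induction k with
      | zero => ext; simp
      | succ k ih => rw [pow_succ, ih, pow_succ]; ext; simp [mul_assoc]
    simpa only [map_smul, hpow] using this
  have h2 : exp (-(ContinuousLinearMap.mul ℝ A).flip x) =
      (ContinuousLinearMap.mul ℝ A).flip (exp (-x)) := by
    have := (exp_series_hasSum_exp' (𝕂 := ℝ) (-x)).mapL (ContinuousLinearMap.mul ℝ A).flip
    refine (exp_series_hasSum_exp' (𝕂 := ℝ) (-(ContinuousLinearMap.mul ℝ A).flip x)).unique ?_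
    have hpow : ∀ k : ℕ, (-(ContinuousLinearMap.mul ℝ A).flip x) ^ k =
        (ContinuousLinearMap.mul ℝ A).flip ((-x) ^ k) := by
      intro k
      induction k with
      | zero => ext; simp
      | succ k ih => rw [pow_succ', ih, pow_succ]; ext; simp [mul_assoc]
    simpa only [map_smul, hpow] using this
  rw [h1, h2]
  simp [mul_assoc]

theorem exp_mul_mul_exp_neg_mem {W : Submodule ℝ A} (hW : IsClosed (W : Set A)) {x y : A}
    (hx : ∀ v ∈ W, x * v - v * x ∈ W) (hy : y ∈ W) : exp x * y * exp (-x) ∈ W := by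
  rw [exp_mul_mul_exp_neg]
  exact ContinuousLinearMap.exp_apply_mem _ hW (by simpa using hx) hy

end

/-! ### Families with logarithmic derivative in a subalgebra -/

section
variable {A : Type*} [NormedRing A] [NormedAlgebra ℝ A]
  {Z : Type*} [NormedAddCommGroup Z] [NormedSpace ℝ Z]

/-- `f` is an analytic family of units with inverses `g`, normalizing `W` and whose left
logarithmic derivative takes values in `W`. -/
structure IsLeftTangent (W : Submodule ℝ A) (f g : Z → A) : Prop where
  mul_inv : ∀ z, f z * g z = 1
  inv_mul : ∀ z, g z * f z = 1
  conj_mem : ∀ z, ∀ y ∈ W, f z * y * g z ∈ W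
  conj_inv_mem : ∀ z, ∀ y ∈ W, g z * y * f z ∈ W
  analyticAt : ∀ z, AnalyticAt ℝ f z
  fderiv_mem : ∀ z v, g z * fderiv ℝ f z v ∈ W

namespace IsLeftTangent

variable {W : Submodule ℝ A}

theorem one : IsLeftTangent W (fun _ : Z => 1) (fun _ => 1) where
  mul_inv := by simp
  inv_mul := by simp
  conj_mem := by simp
  conj_inv_mem := by simp
  analyticAt _ := analyticAt_const
  fderiv_mem := by simp

/-- The logarithmic derivative of f₁f₂ is that of f₂ plus that of f₁ conjugated by f₂⁻¹; this is why
normalizing `W` is part of the structure. -/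
theorem mul {f₁ g₁ f₂ g₂ : Z → A} (h₁ : IsLeftTangent W f₁ g₁) (h₂ : IsLeftTangent W f₂ g₂) :
    IsLeftTangent W (fun z => f₁ z * f₂ z) (fun z => g₂ z * g₁ z) where
  mul_inv z := by
    rw [mul_assoc, ← mul_assoc (f₂ z), h₂.mul_inv, one_mul, h₁.mul_inv]
  inv_mul z := by
    rw [mul_assoc, ← mul_assoc (g₁ z), h₁.inv_mul, one_mul, h₂.inv_mul]
  conj_mem z y hy := by
    simpa [mul_assoc] using h₁.conj_mem z _ (h₂.conj_mem z y hy)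
  conj_inv_mem z y hy := by
    simpa [mul_assoc] using h₂.conj_inv_mem z _ (h₁.conj_inv_mem z y hy)
  analyticAt z := (h₁.analyticAt z).mul (h₂.analyticAt z)
  fderiv_mem z v := by
    rw [fderiv_fun_mul' (h₁.analyticAt z).differentiableAt (h₂.analyticAt z).differentiableAt]
    have e : g₂ z * g₁ z * (f₁ z * fderiv ℝ f₂ z v + fderiv ℝ f₁ z v * f₂ z) =
        g₂ z * (g₁ z * f₁ z) * fderiv ℝ f₂ z v + g₂ z * (g₁ z * fderiv ℝ f₁ z v) * f₂ z := by
      noncomm_ring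
    simp only [add_apply, smul_apply, smul_eq_mul,
      MulOpposite.smul_eq_mul_unop, MulOpposite.unop_op]
    rw [e, h₁.inv_mul, mul_one]
    exact W.add_mem (h₂.fderiv_mem z v) (h₂.conj_inv_mem z _ (h₁.fderiv_mem z v))

end IsLeftTangent

variable [CompleteSpace A]

theorem hasFDerivAt_exp_clm_smul (ℓ : Z →L[ℝ] ℝ) (x : A) (z : Z) :
    HasFDerivAt (fun z => exp (ℓ z • x)) (ℓ.smulRight (exp (ℓ z • x) * x)) z := by
  have := (hasDerivAt_exp_smul_const (𝕂 := ℝ) x (ℓ z)).hasFDerivAt.comp z ℓ.hasFDerivAt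
  refine this.congr_fderiv ?_
  ext v
  simp

theorem isLeftTangent_exp_smul {W : Submodule ℝ A} (hWc : IsClosed (W : Set A))
    (hW : ∀ x ∈ W, ∀ y ∈ W, x * y - y * x ∈ W) (ℓ : Z →L[ℝ] ℝ) {x : A} (hx : x ∈ W) :
    IsLeftTangent W (fun z => exp (ℓ z • x)) (fun z => exp (-(ℓ z • x))) where
  mul_inv z := exp_mul_exp_neg_self _
  inv_mul z := exp_neg_mul_exp_self _
  conj_mem z y hy := exp_mul_mul_exp_neg_mem hWc (hW _ (W.smul_mem _ hx)) hy
  conj_inv_mem z y hy := by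
    simpa using exp_mul_mul_exp_neg_mem hWc (hW _ (W.neg_mem (W.smul_mem (ℓ z) hx))) hy
  analyticAt z := (exp_analytic (𝕂 := ℝ) (ℓ z • x)).comp_of_eq
    ((ℓ.analyticAt z).smul analyticAt_const) rfl
  fderiv_mem z v := by
    rw [(hasFDerivAt_exp_clm_smul ℓ x z).fderiv]
    simp only [ContinuousLinearMap.smulRight_apply, mul_smul_comm, ← mul_assoc,
      exp_neg_mul_exp_self, one_mul]
    exact W.smul_mem _ hx

theorem exists_isLeftTangent_list_prod_exp {W : Submodule ℝ A} (hWc : IsClosed (W : Set A))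
    (hW : ∀ x ∈ W, ∀ y ∈ W, x * y - y * x ∈ W) (l : List ((Z →L[ℝ] ℝ) × A))
    (hl : ∀ p ∈ l, p.2 ∈ W) :
    ∃ g, IsLeftTangent W (fun z => (l.map fun p => exp (p.1 z • p.2)).prod) g := by
  induction l with
  | nil => exact ⟨_, by simpa using IsLeftTangent.one⟩
  | cons p l ih =>
    obtain ⟨g, hg⟩ := ih fun p hp => hl p (by simp [hp])
    exact ⟨_, by simpa using (isLeftTangent_exp_smul hWc hW p.1 (hl p (by simp))).mul hg⟩

theorem hasFDerivAt_list_prod_exp (l : List ((Z →L[ℝ] ℝ) × A)) :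
    HasFDerivAt (fun z => (l.map fun p => exp (p.1 z • p.2)).prod)
      (l.map fun p => p.1.smulRight p.2).sum 0 := by
  induction l with
  | nil => simpa using hasFDerivAt_const (1 : A) (0 : Z)
  | cons p l ih =>
    have := (hasFDerivAt_exp_clm_smul p.1 p.2 0).mul' ih
    simp only [List.map_cons, List.prod_cons, List.sum_cons]
    refine this.congr_fderiv ?_
    ext v
    simp [add_comm]

/-- Coordinates of the second kind along a subspace closed under the commutator. -/
theorem exists_isLeftTangent_chart [FiniteDimensional ℝ A] {W : Submodule ℝ A}
    (hW : ∀ x ∈ W, ∀ y ∈ W, x * y - y * x ∈ W) :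
    ∃ E E' : W → A, IsLeftTangent W E E' ∧ E 0 = 1 ∧ HasFDerivAt E W.subtypeL 0 := by
  have hWc : IsClosed (W : Set A) := W.closed_of_finiteDimensional
  let B := Module.finBasis ℝ W
  -- The chart is ∏ exp(z_i B_i) rather than exp(∑ z_i B_i): each factor has an immediate
  -- logarithmic derivative.
  let l : List ((W →L[ℝ] ℝ) × A) := List.ofFn fun i =>
    (LinearMap.toContinuousLinearMap (B.coord i), (B i : A))
  obtain ⟨g, hg⟩ := exists_isLeftTangent_list_prod_exp hWc hW l (by simp [l])
  refine ⟨_, g, hg, by simp [l, Function.comp_def], (hasFDerivAt_list_prod_exp l).congr_fderiv ?_⟩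
  ext v
  have h := congrArg W.subtype (B.sum_repr v)
  simp only [map_sum, map_smul, Submodule.subtype_apply] at h
  simpa [l, List.map_ofFn, List.sum_ofFn] using h

end

/-! ### The local leaf through 1 -/

section
variable {A : Type*} [NormedRing A] [NormedAlgebra ℝ A]

/-- A continuous projection onto a subspace splits the space as kernel times range. -/
noncomputable def Submodule.kerProdEquivOfProj {W : Submodule ℝ A} (π : A →L[ℝ] W) (hπ : ∀ w : W, π w = w) :
    (LinearMap.ker (π : A →ₗ[ℝ] W) × W) ≃L[ℝ] A :=
  ContinuousLinearEquiv.equivOfInverse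
    ((LinearMap.ker (π : A →ₗ[ℝ] W)).subtypeL.coprod W.subtypeL)
    (((ContinuousLinearMap.id ℝ A - W.subtypeL ∘L π).codRestrict _ (by simp [hπ])).prod π)
    (by
      rintro ⟨⟨c, hc⟩, w⟩
      have hc : π c = 0 := hc
      ext <;> simp [hπ, hc])
    (by intro a; simp)

variable [FiniteDimensional ℝ A]

/-- A curve through `1` whose left logarithmic derivative lies in `W` is detected near `1` by its
component along `W`. -/
theorem exists_nhds_one_isLeftTangent_eq_one {W : Submodule ℝ A}
    (hW : ∀ x ∈ W, ∀ y ∈ W, x * y - y * x ∈ W) (π : A →L[ℝ] W) (hπ : ∀ w : W, π w = w) :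
    ∃ U ∈ 𝓝 (1 : A), ∀ γ γ' : ℝ → A, IsLeftTangent W γ γ' → γ 0 = 1 →
      ∀ r > 0, (∀ τ ∈ Metric.ball (0 : ℝ) r, γ τ ∈ U) →
        ∀ t ∈ Metric.ball (0 : ℝ) r, π (γ t - 1) = 0 → γ t = 1 := by
  have : CompleteSpace A := FiniteDimensional.complete ℝ A
  obtain ⟨E, E', hE, hE0, hE1⟩ := exists_isLeftTangent_chart hW
  set C := LinearMap.ker (π : A →ₗ[ℝ] W)
  have hCπ : ∀ c : C, π c = 0 := fun c => c.2
  have : CompleteSpace C := FiniteDimensional.complete ℝ C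
  have : CompleteSpace W := FiniteDimensional.complete ℝ W
  -- Near 1 the slices c = const are the leaves (1 + c)E(W), with c measuring the transverse
  -- position.
  let Φ : C × W → A := fun p => (1 + (p.1 : A)) * E p.2
  have hΦd : ∀ p : C × W, HasFDerivAt Φ
      ((1 + (p.1 : A)) • (fderiv ℝ E p.2 ∘L ContinuousLinearMap.snd ℝ C W) +
        MulOpposite.op (E p.2) • (C.subtypeL ∘L ContinuousLinearMap.fst ℝ C W)) p := fun p => by
    have h1 : HasFDerivAt (fun p : C × W => 1 + (p.1 : A))
        (C.subtypeL ∘L ContinuousLinearMap.fst ℝ C W) p :=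
      (C.subtypeL ∘L ContinuousLinearMap.fst ℝ C W).hasFDerivAt.const_add 1
    have h2 : HasFDerivAt (fun p : C × W => E p.2)
        (fderiv ℝ E p.2 ∘L ContinuousLinearMap.snd ℝ C W) p :=
      (hE.analyticAt p.2).differentiableAt.hasFDerivAt.comp p
        (ContinuousLinearMap.snd ℝ C W).hasFDerivAt
    exact h1.mul' h2
  have hΦ0 : Φ 0 = 1 := by simp [Φ, hE0]
  have hΦc : ContDiffAt ℝ 1 Φ 0 := by
    have h1 : ContDiffAt ℝ 1 (fun p : C × W => 1 + (p.1 : A)) 0 :=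
      contDiffAt_const.add (C.subtypeL ∘L ContinuousLinearMap.fst ℝ C W).contDiff.contDiffAt
    have h2 : ContDiffAt ℝ 1 (fun p : C × W => E p.2) 0 :=
      (hE.analyticAt _).contDiffAt.comp (0 : C × W) contDiffAt_snd
    exact h1.mul h2
  have hΦe : HasFDerivAt Φ (Submodule.kerProdEquivOfProj π hπ : C × W →L[ℝ] A) 0 := by
    refine (hΦd 0).congr_fderiv ?_
    ext p
    · simp [Submodule.kerProdEquivOfProj, hE1.fderiv, hE0]
    · simp [Submodule.kerProdEquivOfProj, hE1.fderiv, hE0]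
  set L := hΦc.localInverse hΦe one_ne_zero
  have hLc : ContDiffAt ℝ 1 L 1 := hΦ0 ▸ hΦc.to_localInverse hΦe one_ne_zero
  have hL1 : L 1 = 0 := hΦ0 ▸ hΦc.localInverse_apply_image hΦe one_ne_zero
  have hLr : ∀ᶠ a in 𝓝 (1 : A), Φ (L a) = a :=
    hΦ0 ▸ (hΦc.hasStrictFDerivAt' hΦe one_ne_zero).eventually_right_inverse
  have hLd : ∀ᶠ a in 𝓝 (1 : A), DifferentiableAt ℝ L a :=
    (hLc.eventually (by simp)).mono fun a ha => ha.differentiableAt one_ne_zero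
  have hinj : ∀ᶠ z in 𝓝 (0 : W), π (E z) = π 1 → z = 0 := by
    have h1 : HasFDerivAt (fun z => π (E z)) (ContinuousLinearMap.id ℝ W) 0 := by
      refine (π.hasFDerivAt.comp (0 : W) hE1).congr_fderiv ?_
      ext z
      simp [hπ]
    have h2 := h1.eventually_ne (c := π 1) ⟨1, fun z => by simp⟩
    rw [eventually_nhdsWithin_iff] at h2
    filter_upwards [h2] with z hz h
    by_contra hne
    exact hz hne h
  have hnorm : ∀ᶠ c : C in 𝓝 (0 : C), ‖π‖ * ‖(c : A)‖ < 1 := by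
    have : Tendsto (fun c : C => ‖π‖ * ‖(c : A)‖) (𝓝 0) (𝓝 (‖π‖ * ‖((0 : C) : A)‖)) :=
      Continuous.tendsto (by fun_prop) 0
    exact this.eventually (gt_mem_nhds (by rw [Submodule.coe_zero, norm_zero, mul_zero]; exact one_pos))
  have hLt : Tendsto L (𝓝 1) (𝓝 (0, 0)) := by
    have := hLc.continuousAt.tendsto
    rwa [hL1] at this
  rw [nhds_prod_eq] at hLt
  refine ⟨_, hLr.and (hLd.and (((tendsto_fst.comp hLt).eventually hnorm).and
    ((tendsto_snd.comp hLt).eventually hinj))), ?_⟩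
  intro γ γ' hγ hγ0 r hr hU t ht hπt
  -- The transverse coordinate is constant along γ. Comparing γ' = γX with the derivative of Φ gives
  -- c' = Q + cQ with Q ∈ W. Since π kills c and c', Q = -π(cQ), which forces Q = 0 once ‖π‖‖c‖ < 1.
  have key : ∀ τ ∈ Metric.ball (0 : ℝ) r, HasDerivAt (fun τ => (L (γ τ)).1) 0 τ := by
    intro τ hτ
    obtain ⟨hr1, hd, hn, -⟩ := hU τ hτ
    have hγd := (hγ.analyticAt τ).differentiableAt.hasDerivAt
    have hpd : HasDerivAt (fun τ => L (γ τ)) (fderiv ℝ L (γ τ) (deriv γ τ)) τ :=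
      hd.hasFDerivAt.comp_hasDerivAt τ hγd
    set p := L (γ τ) with hp
    set v := fderiv ℝ L (γ τ) (deriv γ τ) with hv
    have h1 : deriv γ τ = (1 + (p.1 : A)) * fderiv ℝ E p.2 v.2 + v.1 * E p.2 := by
      have h := (hΦd p).comp_hasDerivAt τ hpd
      have heq : (Φ ∘ fun τ => L (γ τ)) =ᶠ[𝓝 τ] γ := by
        filter_upwards [Metric.isOpen_ball.mem_nhds hτ] with σ hσ using (hU σ hσ).1
      simpa using hγd.unique (h.congr_of_eventuallyEq heq.symm)
    have hX : γ' τ * deriv γ τ ∈ W := by simpa using hγ.fderiv_mem τ 1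
    set X := γ' τ * deriv γ τ
    have h2 : deriv γ τ = (1 + (p.1 : A)) * E p.2 * X := by
      have : (1 + (p.1 : A)) * E p.2 = γ τ := hr1
      rw [this, ← mul_assoc, hγ.mul_inv, one_mul]
    set Y := E' p.2 * fderiv ℝ E p.2 v.2 with hY
    have h3 : fderiv ℝ E p.2 v.2 = E p.2 * Y := by
      rw [hY, ← mul_assoc, hE.mul_inv, one_mul]
    have hQ : E p.2 * (X - Y) * E' p.2 ∈ W :=
      hE.conj_mem _ _ (W.sub_mem hX (hE.fderiv_mem _ _))
    set Q : W := ⟨_, hQ⟩ with hQdef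
    have h4 : (v.1 : A) = Q + p.1 * Q := by
      have h5 : (v.1 : A) * E p.2 = (1 + (p.1 : A)) * (E p.2 * (X - Y)) := by
        rw [mul_sub, mul_sub, ← h3, ← mul_assoc (1 + (p.1 : A)) (E p.2), ← h2, h1]
        abel
      have h6 : (v.1 : A) = v.1 * E p.2 * E' p.2 := by rw [mul_assoc, hE.mul_inv, mul_one]
      rw [h6, h5, hQdef, mul_assoc]
      simp only [add_mul, one_mul, mul_assoc]
    have h5 : Q = -π (p.1 * Q) := by
      have := congrArg π h4
      rw [hCπ, map_add, hπ] at this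
      exact eq_neg_of_add_eq_zero_left this.symm
    have h6 : ‖Q‖ ≤ ‖π‖ * ‖(p.1 : A)‖ * ‖Q‖ := by
      calc ‖Q‖ = ‖π (p.1 * Q)‖ := by rw [h5, norm_neg, ← h5]
        _ ≤ ‖π‖ * (‖(p.1 : A)‖ * ‖(Q : A)‖) :=
          (π.le_opNorm _).trans (by gcongr; exact norm_mul_le _ _)
        _ = _ := by rw [mul_assoc]; rfl
    have h7 : Q = 0 := by
      rw [← norm_eq_zero]
      have hn' : ‖π‖ * ‖(p.1 : A)‖ < 1 := hn
      nlinarith [norm_nonneg Q]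
    have h8 : v.1 = 0 := by
      rw [h7] at h4
      simpa using h4
    have h9 := (ContinuousLinearMap.fst ℝ C W).hasFDerivAt.comp_hasDerivAt τ hpd
    rw [ContinuousLinearMap.coe_fst', h8] at h9
    exact h9
  have hconst : (L (γ t)).1 = (L (γ 0)).1 :=
    Metric.isOpen_ball.is_const_of_deriv_eq_zero (convex_ball _ _).isPreconnected
      (fun τ hτ => (key τ hτ).differentiableAt.differentiableWithinAt)
      (fun τ hτ => (key τ hτ).deriv) ht (Metric.mem_ball_self hr)
  rw [hγ0, hL1] at hconst
  obtain ⟨hr1, -, -, hz⟩ := hU t ht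
  have h1 : E (L (γ t)).2 = γ t := by
    have h : (1 + ((L (γ t)).1 : A)) * E (L (γ t)).2 = γ t := hr1
    simpa [hconst] using h
  have h2 : (L (γ t)).2 = 0 := hz (by
    simp only [Function.comp_apply]
    rw [h1]
    simpa [sub_eq_zero] using hπt)
  rw [← h1, h2, hE0]

end

/-! ### Second order expansions in t -/

section
variable {A : Type*} [NormedRing A] [NormedAlgebra ℝ A]
  {P : Type*} [NormedAddCommGroup P] [NormedSpace ℝ P]

/-- `f (t, p) = 1 + t a + t² R (t, p)` with `R` analytic and `R (0, p) = k p`. -/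
def HasSecondOrderExpansion (f : ℝ × P → A) (a : A) (k : P → A) : Prop :=
  ∃ R : ℝ × P → A, AnalyticOnNhd ℝ R Set.univ ∧ (∀ p, R (0, p) = k p) ∧
    ∀ t p, f (t, p) = 1 + t • a + t ^ 2 • R (t, p)

/-- Splitting off the constants `q` and `r` shows that the cross term `a * b` is independent of `p`,
so the dependence on `p` at t = 0 stays additive. -/
theorem HasSecondOrderExpansion.mul {f g : ℝ × P → A} {a b q r : A} {k l : P → A}
    (hf : HasSecondOrderExpansion f a fun p => q + k p)
    (hg : HasSecondOrderExpansion g b fun p => r + l p) :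
    HasSecondOrderExpansion (fun z => f z * g z) (a + b)
      fun p => (q + r + a * b) + (k p + l p) := by
  obtain ⟨R, hR, hR0, hRf⟩ := hf
  obtain ⟨S, hS, hS0, hSg⟩ := hg
  refine ⟨fun z => R z + S z + a * b + z.1 • (a * S z + R z * b) + z.1 ^ 2 • (R z * S z),
    fun z hz => ?_, fun p => ?_, fun t p => ?_⟩
  · have := hR z hz
    have := hS z hz
    have : AnalyticAt ℝ (fun z : ℝ × P => z.1) z := analyticAt_fst
    fun_prop
  · simp only [hR0, hS0]
    simp
    abel
  · simp only [hRf, hSg, mul_add, add_mul, one_mul, mul_one, smul_mul_assoc, mul_smul_comm,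
      smul_add, smul_smul]
    module

theorem HasSecondOrderExpansion.exp [CompleteSpace A] (a : A) {B : ℝ × P → A}
    (hB : AnalyticOnNhd ℝ B Set.univ) :
    ∃ q, HasSecondOrderExpansion (fun z => exp (z.1 • (a + z.1 • B z))) a
      fun p => q + B (0, p) := by
  obtain ⟨φ, hφ, hexp⟩ := exists_analyticOnNhd_exp_eq A
  refine ⟨a * a * φ 0, fun z => B z + (a + z.1 • B z) * (a + z.1 • B z) *
    φ (z.1 • (a + z.1 • B z)), fun z hz => ?_, fun p => ?_, fun t p => ?_⟩
  · have := hB z hz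
    have : AnalyticAt ℝ (fun z : ℝ × P => z.1) z := analyticAt_fst
    have h1 : AnalyticAt ℝ (fun z : ℝ × P => z.1 • (a + z.1 • B z)) z := by fun_prop
    have h2 : AnalyticAt ℝ (fun z : ℝ × P => φ (z.1 • (a + z.1 • B z))) z :=
      (hφ _ (Set.mem_univ _)).comp_of_eq h1 rfl
    have h3 : AnalyticAt ℝ (fun z : ℝ × P => a + z.1 • B z) z := by fun_prop
    exact (hB z hz).add ((h3.mul h3).mul h2)
  · simp [add_comm]
  · have h : ∀ x y : A, (t • x) * (t • x) * y = t ^ 2 • (x * x * y) := fun x y => by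
      rw [smul_mul_smul_comm, smul_mul_assoc, pow_two]
    simp only [hexp, h]
    module

theorem HasSecondOrderExpansion.list_prod_exp [CompleteSpace A]
    (l : List (A × (ℝ × P → A))) (hl : ∀ x ∈ l, AnalyticOnNhd ℝ x.2 Set.univ) :
    ∃ q, HasSecondOrderExpansion
      (fun z => (l.map fun x => NormedSpace.exp (z.1 • (x.1 + z.1 • x.2 z))).prod)
      (l.map Prod.fst).sum fun p => q + (l.map fun x => x.2 (0, p)).sum := by
  induction l with
  | nil => exact ⟨0, 0, analyticOnNhd_const, by simp, by simp⟩
  | cons x l ih =>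
    obtain ⟨q, hq⟩ := HasSecondOrderExpansion.exp x.1 (hl x (by simp))
    obtain ⟨r, hr⟩ := ih fun y hy => hl y (by simp [hy])
    exact ⟨_, by simpa using hq.mul hr⟩

/-- First order expansion of the conjugate of `b` by `exp (t s)`. -/
theorem exists_analyticOnNhd_exp_conj_eq [CompleteSpace A] (b : A) :
    ∃ V : ℝ × A → A, AnalyticOnNhd ℝ V Set.univ ∧ (∀ s, V (0, s) = s * b - b * s) ∧
      ∀ t s, exp (t • s) * b * exp (-(t • s)) = b + t • V (t, s) := by
  obtain ⟨φ, hφ, hexp⟩ := exists_analyticOnNhd_exp_eq A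
  let u : ℝ × A → A := fun z => z.2 + z.1 • (z.2 * z.2 * φ (z.1 • z.2))
  let v : ℝ × A → A := fun z => -z.2 + z.1 • (z.2 * z.2 * φ (-(z.1 • z.2)))
  refine ⟨fun z => u z * b + b * v z + z.1 • (u z * b * v z), fun z _ => ?_, fun s => ?_,
    fun t s => ?_⟩
  · have hfst : AnalyticAt ℝ (fun z : ℝ × A => z.1) z := analyticAt_fst
    have hsnd : AnalyticAt ℝ (fun z : ℝ × A => z.2) z := analyticAt_snd
    have h1 : AnalyticAt ℝ (fun z : ℝ × A => z.1 • z.2) z := by fun_prop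
    have h2 : AnalyticAt ℝ (fun z : ℝ × A => φ (z.1 • z.2)) z :=
      (hφ _ (Set.mem_univ _)).comp_of_eq h1 rfl
    have h3 : AnalyticAt ℝ (fun z : ℝ × A => φ (-(z.1 • z.2))) z :=
      (hφ _ (Set.mem_univ _)).comp_of_eq h1.neg rfl
    have hu : AnalyticAt ℝ u z := hsnd.add (hfst.smul ((hsnd.mul hsnd).mul h2))
    have hv : AnalyticAt ℝ v z := hsnd.neg.add (hfst.smul ((hsnd.mul hsnd).mul h3))
    fun_prop
  · simp [u, v, sub_eq_add_neg]
  · have h1 : exp (t • s) = 1 + t • u (t, s) := by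
      simp only [hexp, u, smul_mul_assoc, mul_smul_comm, smul_add, smul_smul]
      module
    have h2 : exp (-(t • s)) = 1 + t • v (t, s) := by
      simp only [hexp, v, smul_mul_assoc, mul_smul_comm, smul_add, smul_smul, neg_mul_neg, smul_neg]
      module
    rw [h1, h2]
    simp only [mul_add, add_mul, one_mul, mul_one, smul_mul_assoc, mul_smul_comm, smul_add,
      smul_smul]
    module

end

/-- Analytic solution of `F (t, y) = 0` when `F (0, y) = q + y`. -/
theorem exists_analyticAt_zero_of_apply_zero_eq {E : Type*} [NormedAddCommGroup E]
    [NormedSpace ℝ E] [CompleteSpace E] {F : ℝ × E → E} {q : E} (hF : AnalyticOnNhd ℝ F Set.univ)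
    (hF0 : ∀ y, F (0, y) = q + y) :
    ∃ y : ℝ → E, AnalyticAt ℝ y 0 ∧ ∀ᶠ t in 𝓝 0, F (t, y t) = 0 := by
  have hc : ContDiffAt ℝ ⊤ F (0, -q) := (hF _ (Set.mem_univ _)).contDiffAt
  have hd : fderiv ℝ F (0, -q) ∘L .inr ℝ ℝ E = ContinuousLinearMap.id ℝ E := by
    have h1 : HasFDerivAt (fun y => F (0, y)) (fderiv ℝ F (0, -q) ∘L .inr ℝ ℝ E) (-q) :=
      (hc.differentiableAt (by simp)).hasFDerivAt.comp (-q) (hasFDerivAt_prodMk_right 0 (-q))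
    refine h1.unique ?_
    simp only [hF0]
    exact (hasFDerivAt_id (-q)).const_add q
  have hi : (fderiv ℝ F (0, -q) ∘L .inr ℝ ℝ E).IsInvertible := by
    rw [hd]
    exact ⟨ContinuousLinearEquiv.refl ℝ E, rfl⟩
  refine ⟨hc.implicitFunction (by simp) hi,
    (hc.contDiffAt_implicitFunction (by simp) hi).analyticAt, ?_⟩
  filter_upwards [hc.eventually_apply_implicitFunction (by simp) hi] with t ht
  rw [ht, hF0, add_neg_cancel]

/-! ### Solving the equation -/

section
variable {A : Type*} [NormedRing A] [NormedAlgebra ℝ A]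

theorem exp_smul_exp_conj [CompleteSpace A] (t : ℝ) (x b : A) :
    exp (t • (exp x * b * exp (-x))) = exp x * exp (t • b) * exp (-x) := by
  let := NormedAlgebra.restrictScalars ℚ ℝ A
  have := exp_units_conj ⟨exp x, exp (-x), exp_mul_exp_neg_self x, exp_neg_mul_exp_self x⟩ (t • b)
  simpa using this

theorem exists_analyticOnNhd_exp_sum_eq_conj_prod [FiniteDimensional ℝ A] {m : ℕ}
    (𝔟 : Fin m → Submodule ℝ A) (𝔰 W : Submodule ℝ A) (c : ∀ i, 𝔟 i)
    (hW : ∀ x ∈ W, ∀ y ∈ W, x * y - y * x ∈ W) (h𝔟 : ∀ i, 𝔟 i ≤ W)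
    (h𝔰 : ∀ s ∈ 𝔰, ∀ y ∈ W, s * y - y * s ∈ W)
    (hsurj : ∀ w ∈ W, ∃ (β : ∀ i, 𝔟 i) (s : 𝔰),
      ∑ i, (β i : A) + ((∑ i, (c i : A)) * s - s * ∑ i, (c i : A)) = w) :
    ∃ t₀ : ℝ, 0 < t₀ ∧ ∃ (b : ℝ → ∀ i, 𝔟 i) (s : ℝ → 𝔰),
      AnalyticOnNhd ℝ (fun t => (b t, s t)) (Set.Ioo (-t₀) t₀) ∧ b 0 = c ∧
      ∀ t ∈ Set.Ioo (-t₀) t₀, exp (t • ∑ i, (c i : A)) =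
        exp (-(t • (s t : A))) * (List.ofFn fun i => exp (t • (b t i : A))).prod *
          exp (t • (s t : A)) := by
  have : CompleteSpace A := FiniteDimensional.complete ℝ A
  have : CompleteSpace W := FiniteDimensional.complete ℝ W
  have hWc : IsClosed (W : Set A) := W.closed_of_finiteDimensional
  set a : A := ∑ i, (c i : A) with ha
  have haW : a ∈ W := W.sum_mem fun i _ => h𝔟 i (c i).2
  let T : ((∀ i, 𝔟 i) × 𝔰) →ₗ[ℝ] W :=
    { toFun := fun p => ⟨∑ i, (p.1 i : A) + (a * p.2 - p.2 * a), W.add_mem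
        (W.sum_mem fun i _ => h𝔟 i (p.1 i).2)
        (by simpa using W.neg_mem (h𝔰 p.2 p.2.2 a haW))⟩
      map_add' := fun p q => by
        ext
        simp [Finset.sum_add_distrib, mul_add, add_mul]
        abel
      map_smul' := fun r p => by
        ext
        simp [Finset.smul_sum, smul_sub] }
  have hT : LinearMap.range T = ⊤ := by
    rw [LinearMap.range_eq_top]
    rintro ⟨w, hw⟩
    obtain ⟨β, s, h⟩ := hsurj w hw
    exact ⟨(β, s), Subtype.ext h⟩
  obtain ⟨N₀, hN₀⟩ := T.exists_rightInverse_of_surjective hT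
  let N : W →L[ℝ] (∀ i, 𝔟 i) × 𝔰 := LinearMap.toContinuousLinearMap N₀
  have hN : ∀ w : W, ∑ i, ((N w).1 i : A) + (a * (N w).2 - (N w).2 * a) = w := fun w =>
    congrArg Subtype.val (LinearMap.congr_fun hN₀ w)
  obtain ⟨π₀, hπ₀⟩ := LinearMap.exists_leftInverse_of_injective W.subtype W.ker_subtype
  let π : A →L[ℝ] W := LinearMap.toContinuousLinearMap π₀
  have hπ : ∀ w : W, π w = w := fun w => LinearMap.congr_fun hπ₀ w
  obtain ⟨V, hV, hV0, hVeq⟩ := exists_analyticOnNhd_exp_conj_eq a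
  let Ns : W →L[ℝ] A := 𝔰.subtypeL ∘L .snd ℝ _ _ ∘L N
  let Nb : ∀ i, W →L[ℝ] A := fun i => (𝔟 i).subtypeL ∘L .proj i ∘L .fst ℝ _ _ ∘L N
  -- The leading entry is the factor exp(-tw), since w = a + tV(t, s).
  obtain ⟨q, R, hR, hR0, hRf⟩ := HasSecondOrderExpansion.list_prod_exp (P := W)
    ((-a, fun z => -V (z.1, Ns z.2)) :: List.ofFn fun i => ((c i : A), fun z => Nb i z.2)) (by
      simp only [List.mem_cons, List.mem_ofFn, forall_eq_or_imp, forall_exists_index]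
      refine ⟨fun z _ => ((hV _ (Set.mem_univ _)).comp_of_eq
        (analyticAt_fst.prod ((Ns.analyticAt _).comp analyticAt_snd)) rfl).neg, ?_⟩
      rintro _ i rfl z -
      exact ((Nb i).analyticAt _).comp analyticAt_snd)
  have hR0' : ∀ p : W, R (0, p) = q + p := fun p => by
    rw [hR0, ← hN p]
    simp only [List.map_cons, List.map_ofFn, List.sum_cons, List.sum_ofFn, Function.comp_def, hV0]
    simp [Ns, Nb]
    abel
  have hzero : (List.map Prod.fst ((-a, fun z : ℝ × W => -V (z.1, Ns z.2)) ::
      List.ofFn fun i => ((c i : A), fun z : ℝ × W => Nb i z.2))).sum = 0 := by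
    simp [List.map_ofFn, List.sum_ofFn, Function.comp_def, ha]
  rw [hzero] at hRf
  -- The constant `q` need not lie in `W`, so only the projected equation can be solved.
  obtain ⟨y, hy, hy0⟩ := exists_analyticAt_zero_of_apply_zero_eq (F := fun z => π (R z)) (q := π q)
    (fun z hz => (π.analyticAt _).comp (hR z hz)) (fun p => by simp [hR0', hπ])
  obtain ⟨U, hU, hleaf⟩ := exists_nhds_one_isLeftTangent_eq_one hW π hπ
  let b : ℝ → ∀ i, 𝔟 i := fun t => c + t • (N (y t)).1
  let s : ℝ → 𝔰 := fun t => (N (y t)).2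
  let w : ℝ → A := fun t => exp (t • (s t : A)) * a * exp (-(t • (s t : A)))
  have hwW : ∀ t, w t ∈ W := fun t => exp_mul_mul_exp_neg_mem hWc
    (h𝔰 _ (𝔰.smul_mem _ (s t).2)) haW
  let G : ℝ × A × (Fin m → A) → A := fun z =>
    exp (z.1 • -z.2.1) * (List.ofFn fun i => exp (z.1 • z.2.2 i)).prod
  have hG : Continuous G := by
    let := NormedAlgebra.restrictScalars ℚ ℝ A
    simp only [G, List.ofFn_eq_map]
    refine Continuous.mul (by fun_prop) (continuous_list_prod _ fun i _ => by fun_prop)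
  have hG0 : ∀ z, G (0, z) = 1 := fun z => by simp [G]
  have hana : ∀ t, AnalyticAt ℝ y t → AnalyticAt ℝ (fun t => (b t, s t)) t := fun t ht => by
    have h := (ContinuousLinearMap.analyticAt (E := W) (F := (∀ i, 𝔟 i) × 𝔰) N (y t)).comp ht
    exact (analyticAt_const.add (analyticAt_id.smul (analyticAt_fst.comp h))).prod
      (analyticAt_snd.comp h)
  have hbs := (hana 0 hy).continuousAt
  -- The curve time τ and the parameter t are decoupled: for each small t the whole curve in τ must
  -- stay in `U`, on a ball independent of t.
  have hev : ∀ᶠ z : ℝ × ℝ in 𝓝 (0, 0), G (z.1, w z.2, fun i => b z.2 i) ∈ U := by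
    let := NormedAlgebra.restrictScalars ℚ ℝ A
    have hs : ContinuousAt s 0 := hbs.snd
    have hb : ContinuousAt b 0 := hbs.fst
    have hs' : ContinuousAt (fun t => (s t : A)) 0 := continuous_subtype_val.continuousAt.comp hs
    have hb' : ContinuousAt (fun t i => (b t i : A)) 0 := continuousAt_pi.2 fun i =>
      continuous_subtype_val.continuousAt.comp (continuousAt_pi.1 hb i)
    have hw : ContinuousAt w 0 := by
      have h1 : ContinuousAt (fun t : ℝ => t • (s t : A)) 0 := continuousAt_id.smul hs'
      exact ((exp_continuous.continuousAt.comp h1).mul continuousAt_const).mul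
        (exp_continuous.continuousAt.comp h1.neg)
    have hwb : ContinuousAt (fun z : ℝ × ℝ => (z.1, w z.2, fun i => (b z.2 i : A))) (0, 0) :=
      continuousAt_fst.prodMk ((hw.comp_of_eq continuousAt_snd rfl).prodMk
        (hb'.comp_of_eq continuousAt_snd rfl))
    have h := hG.continuousAt.comp hwb
    exact h.eventually_mem (by simpa [hG0] using hU)
  obtain ⟨ε, hε, hεU⟩ := Metric.eventually_nhds_iff_ball.1 hev
  obtain ⟨δ, hδ, hδy⟩ := Metric.eventually_nhds_iff_ball.1 (hy.eventually_analyticAt.and hy0)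
  refine ⟨min ε δ, lt_min hε hδ, b, s, fun t ht => ?_, by simp [b], fun t ht => ?_⟩
  · refine hana t (hδy t ?_).1
    rw [Real.ball_eq_Ioo]
    exact ⟨by linarith [ht.1, min_le_right ε δ], by linarith [ht.2, min_le_right ε δ]⟩
  have htδ : t ∈ Metric.ball (0 : ℝ) δ := by
    rw [Real.ball_eq_Ioo]
    exact ⟨by linarith [ht.1, min_le_right ε δ], by linarith [ht.2, min_le_right ε δ]⟩
  have htε : t ∈ Metric.ball (0 : ℝ) ε := by
    rw [Real.ball_eq_Ioo]
    exact ⟨by linarith [ht.1, min_le_left ε δ], by linarith [ht.2, min_le_left ε δ]⟩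
  have hGR : G (t, w t, fun i => b t i) = 1 + t ^ 2 • R (t, y t) := by
    have h := hRf t (y t)
    rw [smul_zero, add_zero] at h
    rw [← h]
    simp only [G, w, List.map_cons, List.map_ofFn, List.prod_cons, Function.comp_def]
    rw [hVeq, neg_add, ← smul_neg]
    rfl
  -- With t frozen, `w t` and `b t` are constant elements of `W` and only τ varies.
  obtain ⟨γ', hγ'⟩ := exists_isLeftTangent_list_prod_exp (Z := ℝ) hWc hW
    ((.id ℝ ℝ, -w t) :: List.ofFn fun i => (.id ℝ ℝ, (b t i : A))) (by
      simp only [List.mem_cons, List.mem_ofFn, forall_eq_or_imp, forall_exists_index]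
      refine ⟨W.neg_mem (hwW t), ?_⟩
      rintro _ i rfl
      exact h𝔟 i (b t i).2)
  have hγ : IsLeftTangent W (fun τ => G (τ, w t, fun i => b t i)) γ' := by
    simpa [G, List.map_ofFn, Function.comp_def] using hγ'
  have hone : G (t, w t, fun i => b t i) = 1 := by
    refine hleaf _ _ hγ (hG0 _) ε hε (fun τ hτ => ?_) t htε ?_
    · refine hεU (τ, t) ?_
      rw [← ball_prod_same]
      exact ⟨hτ, htε⟩
    · simp [hGR, (hδy t htδ).2]
  have hprod : (List.ofFn fun i => exp (t • (b t i : A))).prod = exp (t • w t) := by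
    have h : exp (t • -w t) * (List.ofFn fun i => exp (t • (b t i : A))).prod = 1 := hone
    rw [← one_mul (List.prod _), ← exp_mul_exp_neg_self (t • w t), mul_assoc, ← smul_neg, h,
      mul_one]
  rw [hprod, exp_smul_exp_conj]
  simp only [mul_assoc, exp_neg_mul_exp_self, mul_one]
  rw [← mul_assoc, exp_neg_mul_exp_self, one_mul]

end

theorem mainTheorem2 {n m : ℕ} (hm : 0 < m)
    (𝔥 : LieSubalgebra ℝ (Matrix (Fin n) (Fin n) ℝ))
    (𝔟 : Fin m → Submodule ℝ (Matrix (Fin n) (Fin n) ℝ))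
    (𝔰 : Submodule ℝ (Matrix (Fin n) (Fin n) ℝ))
    (h𝔟 : ∀ i, 𝔟 i ≤ 𝔥.toSubmodule) (h𝔰 : 𝔰 ≤ 𝔥.toSubmodule)
    (hcompl : iSupIndep 𝔟)
    (bstar : Fin m → Matrix (Fin n) (Fin n) ℝ) (hbstar : ∀ i, bstar i ∈ 𝔟 i)
    (𝔤 : LieSubalgebra ℝ (Matrix (Fin n) (Fin n) ℝ))
    (h𝔤 : 𝔤.toSubmodule =
      (⨆ i, 𝔟 i) ⊔ 𝔰.map (LieAlgebra.ad ℝ (Matrix (Fin n) (Fin n) ℝ) (∑ i, bstar i)))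
    (hnorm : ∀ x ∈ 𝔰, ∀ y ∈ 𝔤, ⁅x, y⁆ ∈ 𝔤) :
    ∃ t₀ : ℝ, 0 < t₀ ∧ ∃ (b : ℝ → ∀ i, 𝔟 i) (s : ℝ → 𝔰),
      AnalyticOnNhd ℝ (fun t => (b t, s t)) (Set.Ioo (-t₀) t₀) ∧
      (∀ i, (b 0 i : Matrix (Fin n) (Fin n) ℝ) = bstar i) ∧
      ∀ t ∈ Set.Ioo (-t₀) t₀,
        NormedSpace.exp (t • ∑ i, bstar i) =
          NormedSpace.exp (-(t • (s t : Matrix (Fin n) (Fin n) ℝ))) *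
            (List.ofFn fun i => NormedSpace.exp (t • (b t i : Matrix (Fin n) (Fin n) ℝ))).prod *
            NormedSpace.exp (t • (s t : Matrix (Fin n) (Fin n) ℝ)) := by
  obtain ⟨t₀, ht₀, b, s, hana, hb0, h⟩ := exists_analyticOnNhd_exp_sum_eq_conj_prod 𝔟 𝔰
    𝔤.toSubmodule (fun i => ⟨bstar i, hbstar i⟩)
    (fun x hx y hy => 𝔤.lie_mem hx hy)
    (fun i => (le_iSup 𝔟 i).trans (le_sup_left.trans h𝔤.ge)) hnorm (by
      intro w hw
      rw [h𝔤, Submodule.mem_sup] at hw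
      obtain ⟨x, hx, y, hy, rfl⟩ := hw
      obtain ⟨s, hs, rfl⟩ := Submodule.mem_map.1 hy
      obtain ⟨f, hf, rfl⟩ := (Submodule.mem_iSup_iff_exists_finsupp _ _).1 hx
      refine ⟨fun i => ⟨f i, hf i⟩, ⟨s, hs⟩, ?_⟩
      rw [Finsupp.sum_fintype _ _ (by simp)]
      rfl)
  exact ⟨t₀, ht₀, b, s, hana, fun i => by rw [hb0], h⟩
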